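/- Let $m\ge 2$, $n_1,\dots,n_m\ge 1$, $n=n_1+\cdots+n_m$, and consider the interconnected system $$\dot x_i=f_i(t,x_1,\dots,x_m),\quad t\ge t_0,\qquad i=1,\dots,m,\qquad x_i\in\mathbb R^{n_i},$$ i.e. $\dot x=f(t,x)$ with $x=(x_1,\dots,x_m)\in\mathbb R^n$ and $f=(f_1,\dots,f_m)$. Assume that $f$ is piecewise continuous in $t$ for every fixed $x$ (finitely many discontinuities in each bounded interval, with one-sided limits), continuously differentiable in $x$ for every $t\ge t_0$, with Jacobian matrix $\partial f/\partial x$ bounded on compact subsets of $[t_0,\infty)\times\mathbb R^n$, and that the system is forward complete: for every $s\ge t_0$ and $x\in\mathbb R^n$ the (absolutely continuous, then unique) solution $t\mapsto\xi(t,s,x)$ with $\xi(s,s,x)=x$ exists on $[s,\infty)$. Put $\xi(t,s,S)=\{\xi(t,s,x):x\in S\}$, and let $\operatorname{co}$ denote the convex hull. Let $K\subset\mathbb R^n$ be compact with nonempty interior and let $|\cdot|$ be any norm on $\mathbb R^n$. The topological entropy is $$h(f,t_0,K)=\lim_{\varepsilon\searrow0}\limsup_{T\to\infty}\frac1T\log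 S(f,t_0,\varepsilon,T,K),$$ where $S(f,t_0,\varepsilon,T,K)$ is the minimal cardinality of a set $E\subset K$ such that for every $\bar x\in K$ there is $x\in E$ with $|\xi(t,t_0,\bar x)-\xi(t,t_0,x)|<\varepsilon$ for all $t\in[t_0,t_0+T]$. Let $|\cdot|_i$ be any norm on $\mathbb R^{n_i}$ for each $i$, and let $|\cdot|_{\mathrm N}$ be any norm on $\mathbb R^m$ that is monotone, i.e. $v\ge w\ge0$ entrywise implies $|v|_{\mathrm N}\ge|w|_{\mathrm N}$. Let $\|A\|_{ij}=\max_{|v|_j=1}|Av|_i$ for $A\in\mathbb R^{n_i\times n_j}$, and let $\mu_i$ and $\mu_{\mathrm N}$ be the matrix measures $\mu(A)=\lim_{s\searrow0}(\|I+sA\|-1)/s$ defined with the norms induced by $|\cdot|_i$ and by $|\cdot|_{\mathrm N}$. Define the interconnection matrix function $A_{\mathrm N}(t,x)=[a_{ij}(t,x)]\in\mathbb R^{m\times m}$ by $$a_{ii}(t,x)=\mu_i\Big(\frac{\partial f_i}{\partial x_i}(t,x)\Big),\qquad a_{ij}(t,x)=\Big\|\frac{\partial f_i}{\partial x_j}(t,x)\Big\|_{ij}\quad(i\ne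 j).$$ Then $$h(f,t_0,K)\le n\max\{\hat\mu^*_{\mathrm N},0\},\qquad \hat\mu^*_{\mathrm N}:=\inf_{t_1\ge t_0}\ \limsup_{t\to\infty}\ \max_{v\in\operatorname{co}(\xi(t_1,t_0,K))}\mu_{\mathrm N}\big(A_{\mathrm N}(t,\xi(t,t_1,v))\big),$$ where $h(f,t_0,K)$ and $\hat\mu^*_{\mathrm N}$ are extended real numbers. -/

import Mathlib

open Set Filter Topology MeasureTheory

noncomputable section

namespace TVEntropy

/-! ### Time-varying systems -/

section Systems

variable {E : Type*} [NormedAddCommGroup E] [NormedSpace ℝ E]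

/-- `g` is piecewise continuous on `[t₀, ∞)`: it has finitely many discontinuities in each bounded
interval, and its one-sided limits exist everywhere. -/
structure PiecewiseContinuousFrom (t₀ : ℝ) (g : ℝ → E) : Prop where
  finite_discontinuities :
    ∀ b : ℝ, {t ∈ Icc t₀ b | ¬ ContinuousWithinAt g (Ici t₀) t}.Finite
  right_limit : ∀ t : ℝ, t₀ ≤ t → ∃ l : E, Tendsto g (𝓝[>] t) (𝓝 l)
  left_limit : ∀ t : ℝ, t₀ < t → ∃ l : E, Tendsto g (𝓝[<] t) (𝓝 l)

/-- The standing regularity of the right-hand side of `x' = f (t, x)`, `t ≥ t₀`: piecewise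
continuous in `t`, continuously differentiable in `x`, with the Jacobian bounded on compact sets
of `(t, x)` (which makes `f` locally Lipschitz in `x`, uniformly for `t` in bounded intervals). -/
structure RegularFrom (t₀ : ℝ) (f : ℝ → E → E) : Prop where
  piecewiseContinuous : ∀ x : E, PiecewiseContinuousFrom t₀ (fun t => f t x)
  contDiff : ∀ t : ℝ, t₀ ≤ t → ContDiff ℝ 1 (f t)
  jacobian_bounded : ∀ (b : ℝ) (C : Set E), IsCompact C →
    ∃ L : ℝ, ∀ t ∈ Icc t₀ b, ∀ x ∈ C, ‖fderiv ℝ (f t) x‖ ≤ L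

/-- `φ` is, on `[s, ∞)`, a solution of `x' = f (t, x)` with `φ s = x`, that is, an absolutely
continuous function that satisfies the equation almost everywhere (integral form). -/
def IsSolution (f : ℝ → E → E) (s : ℝ) (x : E) (φ : ℝ → E) : Prop :=
  ∀ t : ℝ, s ≤ t →
    IntervalIntegrable (fun τ => f τ (φ τ)) volume s t ∧
      φ t = x + ∫ τ in s..t, f τ (φ τ)

/-- From every state at every time `s ≥ t₀` there starts a solution that exists on `[s, ∞)`. -/
def ForwardComplete (t₀ : ℝ) (f : ℝ → E → E) : Prop :=
  ∀ s : ℝ, t₀ ≤ s → ∀ x : E, ∃ φ : ℝ → E, IsSolution f s x φ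

open Classical in
/-- The value `ξ(t, s, x)` at time `t` of the solution with state `x` at time `s`
(only meaningful for `t ≥ s`, and if that solution exists on `[s, ∞)`). -/
def flow (f : ℝ → E → E) (t s : ℝ) (x : E) : E :=
  if h : ∃ φ : ℝ → E, IsSolution f s x φ then h.choose t else x

/-- The reachable set `ξ(t, s, K)`. -/
def reachableSet (f : ℝ → E → E) (t s : ℝ) (K : Set E) : Set E :=
  flow f t s '' K

/-! ### Topological entropy -/

/-- `A ⊆ K` is `(T, ε)`-spanning for the initial set `K` at initial time `t₀`, with respect to
the norm `p`. -/
def IsSpanning (p : Seminorm ℝ E) (f : ℝ → E → E) (t₀ ε T : ℝ) (K A : Set E) : Prop :=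
  A ⊆ K ∧ ∀ y ∈ K, ∃ x ∈ A, ∀ t ∈ Icc t₀ (t₀ + T), p (flow f t t₀ y - flow f t t₀ x) < ε

/-- The minimal cardinality `S(f, t₀, ε, T, K)` of a `(T, ε)`-spanning set. -/
def spanningNumber (p : Seminorm ℝ E) (f : ℝ → E → E) (t₀ ε T : ℝ) (K : Set E) : ℕ∞ :=
  ⨅ (A : Set E) (_ : IsSpanning p f t₀ ε T K A), A.encard

/-- The topological entropy
`h(f, t₀, K) = lim_{ε ↘ 0} limsup_{T → ∞} (1 / T) log S(f, t₀, ε, T, K)`. -/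
def topEntropy (p : Seminorm ℝ E) (f : ℝ → E → E) (t₀ : ℝ) (K : Set E) : EReal :=
  limUnder (𝓝[>] (0 : ℝ)) fun ε =>
    limsup (fun T : ℝ => ((1 / T : ℝ) : EReal) *
      ENNReal.log ((spanningNumber p f t₀ ε T K : ℕ∞) : ENNReal)) atTop

end Systems

/-! ### Norms, induced norms and matrix measures -/

/-- A seminorm that is a norm. -/
def IsNorm {V : Type*} [AddCommGroup V] [Module ℝ V] (p : Seminorm ℝ V) : Prop :=
  ∀ v : V, p v = 0 → v = 0

/-- The norm `p` on `ℝ^ι` is monotone on nonnegative vectors. -/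
def IsMonotoneNorm {ι : Type*} (p : Seminorm ℝ (ι → ℝ)) : Prop :=
  ∀ v w : ι → ℝ, 0 ≤ w → w ≤ v → p w ≤ p v

section Matrices

variable {ι κ : Type*} [Fintype ι] [Fintype κ]

/-- The (mixed) induced norm `max {p (A v) | q v = 1}` of a matrix. -/
def inducedNorm (p : Seminorm ℝ (ι → ℝ)) (q : Seminorm ℝ (κ → ℝ)) (A : Matrix ι κ ℝ) : ℝ :=
  sSup {r : ℝ | ∃ v : κ → ℝ, q v = 1 ∧ p (A.mulVec v) = r}

/-- The matrix measure (logarithmic norm) `lim_{t ↘ 0} (‖I + t A‖ - 1) / t`. -/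
def matrixMeasure [DecidableEq ι] (p : Seminorm ℝ (ι → ℝ)) (A : Matrix ι ι ℝ) : ℝ :=
  limUnder (𝓝[>] (0 : ℝ)) fun t => (inducedNorm p p (1 + t • A) - 1) / t

end Matrices

/-! ### Interconnected systems -/

/-- The state space `ℝ^{n₁} × ⋯ × ℝ^{nₘ}` of an interconnection of `m` subsystems. -/
abbrev State {m : ℕ} (n : Fin m → ℕ) : Type :=
  (i : Fin m) → Fin (n i) → ℝ

section Interconnected

variable {m : ℕ} {n : Fin m → ℕ}

/-- The Jacobian matrix `∂f_i / ∂x_j (t, x)`. -/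
def jacobianBlock (f : ℝ → State n → State n) (t : ℝ) (x : State n) (i j : Fin m) :
    Matrix (Fin (n i)) (Fin (n j)) ℝ :=
  Matrix.of fun a b =>
    fderiv ℝ (f t) x (Pi.single j (Pi.single b (1 : ℝ) : Fin (n j) → ℝ)) i a

/-- The interconnection matrix function `A_N(t, x)`, for the local norms `loc i`. -/
def interconnectionMatrix (loc : (i : Fin m) → Seminorm ℝ (Fin (n i) → ℝ))
    (f : ℝ → State n → State n) (t : ℝ) (x : State n) : Matrix (Fin m) (Fin m) ℝ :=
  Matrix.of fun i j =>
    if i = j then matrixMeasure (loc i) (jacobianBlock f t x i i)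
    else inducedNorm (loc i) (loc j) (jacobianBlock f t x i j)

/-- `inf_{t₁ ≥ t₀} limsup_{t → ∞} max_{v ∈ co(ξ(t₁, t₀, K))} μ_N(A_N(t, ξ(t, t₁, v)))`. -/
def muHatStar (net : Seminorm ℝ (Fin m → ℝ))
    (loc : (i : Fin m) → Seminorm ℝ (Fin (n i) → ℝ))
    (f : ℝ → State n → State n) (t₀ : ℝ) (K : Set (State n)) : EReal :=
  ⨅ (t₁ : ℝ) (_ : t₀ ≤ t₁),
    limsup (fun t : ℝ =>
      ⨆ v ∈ convexHull ℝ (reachableSet f t₁ t₀ K),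
        ((matrixMeasure net (interconnectionMatrix loc f t (flow f t t₁ v)) : ℝ) : EReal)) atTop

end Interconnected

end TVEntropy

end

/-!
Let `φ` and `ψ` be two solutions. To first order `φ - ψ` solves the equation linearized along `ψ`,
and in the norm `N x = |(|x₁|₁, …, |xₘ|ₘ)|_N` the logarithmic norm of the Jacobian is at most
`μ_N (A_N)`, because `|·|_N` is monotone. Suppose that `μ_N (A_N) ≤ c` along all trajectories that
start in `S = co (ξ(t₁, t₀, K))` at time `t₁`. Discounting `N (φ - ψ)` by `e^{-c t}` and letting
`φ → ψ`, the linearization error disappears by dominated convergence, so that `c` bounds the growth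
rate of the local Lipschitz constant of the flow at every point of `S`; neither the variational
equation nor differentiability of the flow is needed. Since `S` is convex, the local bounds
integrate along segments to a Lipschitz constant of order `e^{c t}` on `S`. A set that is covered by
balls of radius of order `ε e^{-c T}` is then `(T, ε)`-spanned by their centres, and in dimension
`n` the bounded set `K` needs at most of order `e^{n c T}` such balls.
-/

open scoped NNReal

noncomputable section

namespace TVEntropy

theorem norm_le_mul_exp_of_norm_le_add_integral {E : Type*} [NormedAddCommGroup E]
    {g : ℝ → E} {a b δ : ℝ} {L : ℝ≥0} (hg : ContinuousOn g (Icc a b))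
    (h : ∀ t ∈ Icc a b, ‖g t‖ ≤ δ + L * ∫ τ in a..t, ‖g τ‖) :
    ∀ t ∈ Icc a b, ‖g t‖ ≤ δ * Real.exp (L * (t - a)) := by
  intro t ht
  have hab : a ≤ b := ht.1.trans ht.2
  set U : ℝ → ℝ := fun t => δ + L * ∫ τ in a..t, ‖g τ‖ with hU
  have hδ : 0 ≤ δ := by simpa using (norm_nonneg _).trans (h a (left_mem_Icc.2 hab))
  have hUderiv : ∀ x ∈ Icc a b, HasDerivWithinAt U (L * ‖g x‖) (Icc a b) x := by
    intro x hx
    have : Fact (x ∈ Icc a b) := ⟨hx⟩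
    have hint : IntervalIntegrable (fun τ => ‖g τ‖) volume a x :=
      ContinuousOn.intervalIntegrable
        (by rw [uIcc_of_le hx.1]; exact hg.norm.mono (Icc_subset_Icc_right hx.2))
    exact ((intervalIntegral.integral_hasDerivWithinAt_right hint
      (hg.norm.stronglyMeasurableAtFilter_nhdsWithin measurableSet_Icc x)
      (hg.norm x hx)).const_mul _).const_add _
  have hUle : ∀ x ∈ Icc a b, ‖U x‖ ≤ δ * Real.exp (L * (x - a)) := by
    simpa only [gronwallBound_ε0] using norm_le_gronwallBound_of_norm_deriv_right_le (ε := 0)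
      (fun x hx => (hUderiv x hx).continuousWithinAt)
      (fun x hx => (hUderiv x (Ico_subset_Icc_self hx)).mono_of_mem_nhdsWithin
        (Icc_mem_nhdsGE_of_mem hx))
      (by simp [hU, abs_of_nonneg hδ] : ‖U a‖ ≤ δ)
      (fun x hx => by
        rw [add_zero, norm_mul, norm_norm, NNReal.norm_eq]
        gcongr
        exact (h x (Ico_subset_Icc_self hx)).trans (Real.le_norm_self _))
  exact (h t ht).trans ((Real.le_norm_self _).trans (hUle t ht))

section Solutions

variable {E : Type*} [NormedAddCommGroup E] [NormedSpace ℝ E]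

/-- The standing hypothesis on the vector field: `f t` is Lipschitz on each ball, uniformly for
`t` in each bounded interval `[t₀, b]`. -/
def IsLocallyLipschitzFrom (t₀ : ℝ) (f : ℝ → E → E) : Prop :=
  ∀ b R : ℝ, ∃ L : ℝ≥0, ∀ t ∈ Icc t₀ b, LipschitzOnWith L (f t) (Metric.closedBall 0 R)

theorem RegularFrom.isLocallyLipschitzFrom [ProperSpace E] {t₀ : ℝ} {f : ℝ → E → E}
    (hf : RegularFrom t₀ f) : IsLocallyLipschitzFrom t₀ f := by
  intro b R
  obtain ⟨L, hL⟩ := hf.jacobian_bounded b (Metric.closedBall 0 R) (isCompact_closedBall 0 R)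
  refine ⟨L.toNNReal, fun t ht => ?_⟩
  exact (convex_closedBall (0 : E) R).lipschitzOnWith_of_nnnorm_fderiv_le (𝕜 := ℝ)
    (fun z _ => (hf.contDiff t ht.1).differentiable one_ne_zero z)
    fun z hz => NNReal.le_toNNReal_of_coe_le (hL t ht z hz)

theorem RegularFrom.differentiable {t₀ : ℝ} {f : ℝ → E → E} (hf : RegularFrom t₀ f) {t : ℝ}
    (ht : t₀ ≤ t) : Differentiable ℝ (f t) :=
  (hf.contDiff t ht).differentiable one_ne_zero

namespace IsSolution

variable {f : ℝ → E → E} {s : ℝ} {x y : E} {φ ψ : ℝ → E}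

theorem apply_self (h : IsSolution f s x φ) : φ s = x := by
  simpa using (h s le_rfl).2

theorem intervalIntegrable (h : IsSolution f s x φ) {a b : ℝ} (ha : s ≤ a) (hb : s ≤ b) :
    IntervalIntegrable (fun τ => f τ (φ τ)) volume a b :=
  (h a ha).1.symm.trans (h b hb).1

theorem sub_eq_integral (h : IsSolution f s x φ) {a b : ℝ} (ha : s ≤ a) (hb : s ≤ b) :
    φ b - φ a = ∫ τ in a..b, f τ (φ τ) := by
  rw [(h a ha).2, (h b hb).2, add_sub_add_left_eq_sub,
    intervalIntegral.integral_interval_sub_left (h b hb).1 (h a ha).1]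

theorem restart (h : IsSolution f s x φ) {a : ℝ} (ha : s ≤ a) : IsSolution f a (φ a) φ := by
  intro t ht
  refine ⟨h.intervalIntegrable ha (ha.trans ht), ?_⟩
  rw [← h.sub_eq_integral ha (ha.trans ht), add_sub_cancel]

theorem continuousOn (h : IsSolution f s x φ) (b : ℝ) : ContinuousOn φ (Icc s b) := by
  rcases lt_or_ge b s with hb | hb
  · simp only [Icc_eq_empty_of_lt hb, continuousOn_empty]
  have hprim : ContinuousOn (fun t => ∫ τ in s..t, f τ (φ τ)) (Icc s b) := by
    simpa only [uIcc_of_le hb] using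
      intervalIntegral.continuousOn_primitive_interval' (h b hb).1 left_mem_uIcc
  exact (continuousOn_const.add hprim).congr fun t ht => (h t ht.1).2

theorem exists_norm_le (h : IsSolution f s x φ) (b : ℝ) : ∃ R, ∀ t ∈ Icc s b, ‖φ t‖ ≤ R :=
  isCompact_Icc.exists_bound_of_continuousOn (h.continuousOn b)

theorem sub_eq_add_integral (hφ : IsSolution f s x φ) (hψ : IsSolution f s y ψ) {t : ℝ}
    (ht : s ≤ t) : φ t - ψ t = x - y + ∫ τ in s..t, (f τ (φ τ) - f τ (ψ τ)) := by
  rw [intervalIntegral.integral_sub (hφ t ht).1 (hψ t ht).1, (hφ t ht).2, (hψ t ht).2,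
    add_sub_add_comm]

theorem norm_sub_le {b : ℝ} {L : ℝ≥0} {B : Set E} (hφ : IsSolution f s x φ)
    (hψ : IsSolution f s y ψ) (hf : ∀ t ∈ Icc s b, LipschitzOnWith L (f t) B)
    (hφB : ∀ t ∈ Icc s b, φ t ∈ B) (hψB : ∀ t ∈ Icc s b, ψ t ∈ B) :
    ∀ t ∈ Icc s b, ‖φ t - ψ t‖ ≤ ‖x - y‖ * Real.exp (L * (t - s)) := by
  have hcont : ContinuousOn (fun t => φ t - ψ t) (Icc s b) :=
    (hφ.continuousOn b).sub (hψ.continuousOn b)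
  refine norm_le_mul_exp_of_norm_le_add_integral hcont fun t ht => ?_
  rw [hφ.sub_eq_add_integral hψ ht.1, ← intervalIntegral.integral_const_mul]
  refine (norm_add_le _ _).trans (add_le_add_right ?_ _)
  refine intervalIntegral.norm_integral_le_of_norm_le ht.1 (ae_of_all _ fun τ hτ => ?_)
    (ContinuousOn.intervalIntegrable ?_)
  · have hτb : τ ∈ Icc s b := ⟨hτ.1.le, hτ.2.trans ht.2⟩
    exact (hf τ hτb).norm_sub_le (hφB τ hτb) (hψB τ hτb)
  · rw [uIcc_of_le ht.1]
    exact continuousOn_const.mul (hcont.norm.mono (Icc_subset_Icc_right ht.2))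

theorem norm_sub_le_of_norm_le {b R : ℝ} {L : ℝ≥0} (hφ : IsSolution f s x φ)
    (hψ : IsSolution f s y ψ)
    (hf : ∀ t ∈ Icc s b, LipschitzOnWith L (f t) (Metric.closedBall 0 (R + 1)))
    (hφR : ∀ t ∈ Icc s b, ‖φ t‖ ≤ R) (hxy : ‖x - y‖ * Real.exp (L * (b - s)) < 1) :
    ∀ t ∈ Icc s b, ‖φ t - ψ t‖ ≤ ‖x - y‖ * Real.exp (L * (t - s)) := by
  have hcont : ContinuousOn (fun t => ‖φ t - ψ t‖) (Icc s b) :=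
    ((hφ.continuousOn b).sub (hψ.continuousOn b)).norm
  refine IsClosed.Icc_subset_of_forall_mem_nhdsWithin
    (s := {t | ‖φ t - ψ t‖ ≤ ‖x - y‖ * Real.exp (L * (t - s))}) ?_ ?_ ?_
  · rw [inter_comm]
    exact isClosed_Icc.isClosed_le hcont (by fun_prop)
  · simp [hφ.apply_self, hψ.apply_self]
  -- Past a time where the bound holds, both solutions stay in the larger ball for a while.
  rintro t ⟨hle, ht⟩
  have hlt : ‖φ t - ψ t‖ < 1 := hle.trans_lt <| hxy.trans_le' <| by gcongr; exact ht.2.le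
  have hev : ∀ᶠ τ in 𝓝[≥] t, ‖φ τ - ψ τ‖ < 1 :=
    ((hcont t (Ico_subset_Icc_self ht)).mono_of_mem_nhdsWithin
      (Icc_mem_nhdsGE_of_mem ht)).eventually_lt_const hlt
  obtain ⟨c, htc, hc⟩ := mem_nhdsGE_iff_exists_Icc_subset.1
    (inter_mem hev (Icc_mem_nhdsGE_of_mem ht))
  refine mem_of_superset (Icc_mem_nhdsGT htc) fun τ hτ => ?_
  have hball : ∀ r ∈ Icc t c, φ r ∈ Metric.closedBall 0 (R + 1) ∧
      ψ r ∈ Metric.closedBall 0 (R + 1) := by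
    intro r hr
    have hφr := hφR r (hc hr).2
    have hφψ : ‖φ r - ψ r‖ < 1 := (hc hr).1
    have hψr := norm_sub_norm_le (ψ r) (φ r)
    rw [norm_sub_rev] at hψr
    simp only [mem_closedBall_zero_iff]
    constructor <;> linarith
  calc ‖φ τ - ψ τ‖ ≤ ‖φ t - ψ t‖ * Real.exp (L * (τ - t)) :=
        (hφ.restart ht.1).norm_sub_le (hψ.restart ht.1) (fun r hr => hf r (hc hr).2)
          (fun r hr => (hball r hr).1) (fun r hr => (hball r hr).2) τ hτ
    _ ≤ ‖x - y‖ * Real.exp (L * (t - s)) * Real.exp (L * (τ - t)) := by gcongr; exact hle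
    _ = ‖x - y‖ * Real.exp (L * (τ - s)) := by
        rw [mul_assoc, ← Real.exp_add]; ring_nf

theorem unique {t₀ t : ℝ} (hφ : IsSolution f s x φ) (hψ : IsSolution f s x ψ)
    (hf : IsLocallyLipschitzFrom t₀ f) (hs : t₀ ≤ s) (ht : s ≤ t) : φ t = ψ t := by
  obtain ⟨R, hR⟩ := hφ.exists_norm_le t
  obtain ⟨L, hL⟩ := hf t (R + 1)
  simpa [sub_eq_zero] using hφ.norm_sub_le_of_norm_le hψ
    (fun τ hτ => hL τ ⟨hs.trans hτ.1, hτ.2⟩) hR (by simp) t (right_mem_Icc.2 ht)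

end IsSolution

namespace ForwardComplete

variable {t₀ s : ℝ} {f : ℝ → E → E}

theorem isSolution_flow (hfc : ForwardComplete t₀ f) (hs : t₀ ≤ s) (x : E) :
    IsSolution f s x (fun t => flow f t s x) := by
  have h := hfc s hs x
  simpa only [flow, dif_pos h] using h.choose_spec

theorem flow_flow (hfc : ForwardComplete t₀ f) (hf : IsLocallyLipschitzFrom t₀ f) {t₁ t : ℝ}
    (hs : t₀ ≤ s) (h₁ : s ≤ t₁) (ht : t₁ ≤ t) (x : E) :
    flow f t t₁ (flow f t₁ s x) = flow f t s x :=
  (hfc.isSolution_flow (hs.trans h₁) _).unique ((hfc.isSolution_flow hs x).restart h₁) hf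
    (hs.trans h₁) ht

theorem eventually_norm_flow_le (hfc : ForwardComplete t₀ f) (hf : IsLocallyLipschitzFrom t₀ f)
    (hs : t₀ ≤ s) (b : ℝ) (x : E) :
    ∃ R, ∀ᶠ y in 𝓝 x, ∀ t ∈ Icc s b, ‖flow f t s y‖ ≤ R := by
  have hx := hfc.isSolution_flow hs x
  obtain ⟨R, hR⟩ := hx.exists_norm_le b
  obtain ⟨L, hL⟩ := hf b (R + 1)
  have hcont : Continuous fun y => ‖x - y‖ * Real.exp (L * (b - s)) := by fun_prop
  have hclose : ∀ᶠ y in 𝓝 x, ‖x - y‖ * Real.exp (L * (b - s)) < 1 :=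
    hcont.continuousAt.eventually_lt_const (by simp)
  refine ⟨R + 1, hclose.mono fun y hy t ht => ?_⟩
  have hdist : ‖flow f t s x - flow f t s y‖ ≤ 1 :=
    (hx.norm_sub_le_of_norm_le (hfc.isSolution_flow hs y)
      (fun τ hτ => hL τ ⟨hs.trans hτ.1, hτ.2⟩) hR hy t ht).trans
      (hy.le.trans' (by gcongr; exact ht.2))
  rw [norm_sub_rev] at hdist
  linarith [norm_sub_norm_le (flow f t s y) (flow f t s x), hR t ht]

theorem exists_norm_flow_le [ProperSpace E] (hfc : ForwardComplete t₀ f)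
    (hf : IsLocallyLipschitzFrom t₀ f) (hs : t₀ ≤ s) (b : ℝ) {S : Set E}
    (hS : Bornology.IsBounded S) : ∃ R, ∀ x ∈ S, ∀ t ∈ Icc s b, ‖flow f t s x‖ ≤ R := by
  suffices h : ∃ R, ∀ x ∈ closure S, ∀ t ∈ Icc s b, ‖flow f t s x‖ ≤ R from
    h.imp fun R hR x hx => hR x (subset_closure hx)
  refine hS.isCompact_closure.induction_on
    (p := fun C => ∃ R, ∀ x ∈ C, ∀ t ∈ Icc s b, ‖flow f t s x‖ ≤ R) ⟨0, by simp⟩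
    (fun A B hAB h => h.imp fun R hR x hx => hR x (hAB hx)) ?_ fun x _ => ?_
  · rintro A B ⟨R₁, h₁⟩ ⟨R₂, h₂⟩
    exact ⟨max R₁ R₂, fun x hx t ht => hx.elim (fun hx => le_max_of_le_left (h₁ x hx t ht))
      fun hx => le_max_of_le_right (h₂ x hx t ht)⟩
  · obtain ⟨R, hR⟩ := hfc.eventually_norm_flow_le hf hs b x
    exact ⟨_, mem_nhdsWithin_of_mem_nhds hR, R, fun y hy => hy⟩

theorem exists_lipschitzOnWith_flow [ProperSpace E] (hfc : ForwardComplete t₀ f)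
    (hf : IsLocallyLipschitzFrom t₀ f) (hs : t₀ ≤ s) (b : ℝ) {S : Set E}
    (hS : Bornology.IsBounded S) :
    ∃ M : ℝ≥0, ∀ t ∈ Icc s b, LipschitzOnWith M (flow f t s) S := by
  obtain ⟨R, hR⟩ := hfc.exists_norm_flow_le hf hs b hS
  obtain ⟨L, hL⟩ := hf b R
  refine ⟨(Real.exp (L * (b - s))).toNNReal, fun t ht => ?_⟩
  refine LipschitzOnWith.of_dist_le_mul fun x hx y hy => ?_
  rw [dist_eq_norm, dist_eq_norm, Real.coe_toNNReal _ (Real.exp_pos _).le, mul_comm]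
  refine ((hfc.isSolution_flow hs x).norm_sub_le (hfc.isSolution_flow hs y)
    (fun τ hτ => hL τ ⟨hs.trans hτ.1, hτ.2⟩) (fun τ hτ => mem_closedBall_zero_iff.2 (hR x hx τ hτ))
    (fun τ hτ => mem_closedBall_zero_iff.2 (hR y hy τ hτ)) t ht).trans ?_
  gcongr
  exact ht.2

end ForwardComplete

end Solutions

section LogarithmicNorm

variable {E : Type*} [NormedAddCommGroup E] [NormedSpace ℝ E] {N : Seminorm ℝ E}

theorem exists_lipschitzWith_seminorm (hN : Continuous N) : ∃ C : ℝ≥0, LipschitzWith C N := by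
  obtain ⟨C, hC, hNC⟩ := N.bound_of_continuous_normedSpace hN
  refine ⟨C.toNNReal, LipschitzWith.of_dist_le_mul fun x y => ?_⟩
  rw [Real.coe_toNNReal _ hC.le, Real.dist_eq, dist_eq_norm]
  exact (abs_sub_map_le_sub N x y).trans (hNC _)

theorem seminorm_sub_le_of_lipschitzOnWith {C M : ℝ≥0} (hN : LipschitzWith C N) {g : E → E}
    {S : Set E} (hg : LipschitzOnWith M g S) {x y : E} (hx : x ∈ S) (hy : y ∈ S) :
    N (g x - g y) ≤ (C * M : ℝ≥0) * ‖x - y‖ := by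
  rw [NNReal.coe_mul, mul_assoc]
  calc N (g x - g y) ≤ C * ‖g x - g y‖ :=
        (Real.le_norm_self _).trans (hN.norm_le_mul (map_zero N) _)
    _ ≤ C * (M * ‖x - y‖) := by
        gcongr
        exact hg.norm_sub_le hx hy

/-- The logarithmic norm of `A` with respect to `N` is at most `c`: the right derivative at `0` of
`s ↦ N (z + s • A z)` is at most `c * N z` for every `z`. -/
def LogNormLE (N : Seminorm ℝ E) (A : E →L[ℝ] E) (c : ℝ) : Prop :=
  ∀ z : E, ∀ ε : ℝ, 0 < ε → ∀ᶠ s : ℝ in 𝓝[>] 0, N (z + s • A z) ≤ N z + s * (c * N z + ε)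

theorem LogNormLE.deriv_le {A : E →L[ℝ] E} {c : ℝ} (hA : LogNormLE N A c) (hN : Continuous N)
    {y : ℝ → E} {t u' : ℝ} {q : E} (hy : HasDerivAt y (A (y t) + q) t)
    (hu : HasDerivAt (fun τ => N (y τ)) u' t) : u' ≤ c * N (y t) + N q := by
  refine le_of_forall_pos_le_add fun ε hε => le_of_tendsto hu.tendsto_slope_zero_right ?_
  set ρ : ℝ → E := fun s => s⁻¹ • (y (t + s) - y t) - (A (y t) + q) with hρ
  have hρ0 : Tendsto (fun s => N (ρ s)) (𝓝[>] 0) (𝓝 0) := by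
    simpa [Function.comp_def] using
      (hN.tendsto _).comp (hy.tendsto_slope_zero_right.sub_const (A (y t) + q))
  filter_upwards [hρ0.eventually_lt_const (half_pos hε), hA (y t) (ε / 2) (half_pos hε),
    self_mem_nhdsWithin] with s hρs hAs (hs : 0 < s)
  have hexpand : y (t + s) = (y t + s • A (y t)) + s • (q + ρ s) := by
    simp only [hρ, smul_add, smul_sub, smul_inv_smul₀ hs.ne']
    abel
  have hle : N (y (t + s)) ≤ N (y t) + s * (c * N (y t) + ε / 2) + s * (N q + N (ρ s)) := by
    rw [hexpand]
    refine (map_add_le_add N _ _).trans (add_le_add hAs ?_)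
    rw [map_smul_eq_mul, Real.norm_of_nonneg hs.le]
    gcongr
    exact map_add_le_add N _ _
  rw [smul_eq_mul, inv_mul_le_iff₀ hs]
  nlinarith

/-- The function `t ↦ N (y t)` discounted from time `a` on at the rate `c`. If
`y' = A y + q` with the logarithmic norm of `A` at most `c`, then only `q` makes it increase. -/
def discountedSeminorm (N : Seminorm ℝ E) (c a : ℝ) (y : ℝ → E) (t : ℝ) : ℝ :=
  Real.exp (-(c * (t - a))) * N (y t)

variable {C : ℝ≥0} {a b c : ℝ}

theorem absolutelyContinuousOnInterval_seminorm (hN : LipschitzWith C N) (hab : a ≤ b)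
    {y : ℝ → E} {K : ℝ≥0} (hy : LipschitzOnWith K y (Icc a b)) :
    AbsolutelyContinuousOnInterval (fun t => N (y t)) a b :=
  (hN.comp_lipschitzOnWith (uIcc_of_le hab ▸ hy)).absolutelyContinuousOnInterval

theorem absolutelyContinuousOnInterval_discountedSeminorm (hN : LipschitzWith C N) (hab : a ≤ b)
    {y : ℝ → E} {K : ℝ≥0} (hy : LipschitzOnWith K y (Icc a b)) :
    AbsolutelyContinuousOnInterval (discountedSeminorm N c a y) a b := by
  have hexp : ContDiff ℝ 1 fun t : ℝ => Real.exp (-(c * (t - a))) := by fun_prop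
  exact hexp.contDiffOn.absolutelyContinuousOnInterval.fun_mul
    (absolutelyContinuousOnInterval_seminorm hN hab hy)

theorem seminorm_le_exp_mul_add_integral (hab : a ≤ b) {y : ℝ → E}
    (hy : AbsolutelyContinuousOnInterval (discountedSeminorm N c a y) a b) :
    N (y b) ≤ Real.exp (c * (b - a)) *
      (N (y a) + ∫ t in a..b, max (deriv (discountedSeminorm N c a y) t) 0) := by
  have hderiv := hy.intervalIntegrable_deriv
  have hmono : ∫ t in a..b, deriv (discountedSeminorm N c a y) t ≤
      ∫ t in a..b, max (deriv (discountedSeminorm N c a y) t) 0 :=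
    intervalIntegral.integral_mono hab hderiv
      (intervalIntegrable_iff.2 (intervalIntegrable_iff.1 hderiv).pos_part)
      fun t => le_max_left _ _
  have ha : discountedSeminorm N c a y a = N (y a) := by simp [discountedSeminorm]
  rw [hy.integral_deriv_eq_sub, ha, discountedSeminorm, Real.exp_neg, sub_le_iff_le_add',
    inv_mul_le_iff₀ (Real.exp_pos _)] at hmono
  exact hmono

theorem ae_deriv_discountedSeminorm_le (hN : LipschitzWith C N) (hab : a ≤ b) {y q : ℝ → E}
    {K : ℝ≥0} (hy : LipschitzOnWith K y (Icc a b)) {A : ℝ → E →L[ℝ] E}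
    (hA : ∀ t ∈ Icc a b, LogNormLE N (A t) c)
    (hd : ∀ᵐ t, t ∈ Icc a b → HasDerivAt y (A t (y t) + q t) t) :
    ∀ᵐ t, t ∈ Icc a b →
      deriv (discountedSeminorm N c a y) t ≤ Real.exp (-(c * (t - a))) * N (q t) := by
  have hu := (absolutelyContinuousOnInterval_seminorm hN hab hy).ae_differentiableAt
  rw [uIcc_of_le hab] at hu
  filter_upwards [hu, hd] with t hu hd ht
  have hu' := (hu ht).hasDerivAt
  have hgrowth := (hA t ht).deriv_le hN.continuous (hd ht) hu'
  have hexp : HasDerivAt (fun t => Real.exp (-(c * (t - a))))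
      (Real.exp (-(c * (t - a))) * -(c * 1)) t :=
    (((hasDerivAt_id t).sub_const a).const_mul c).neg.exp
  have hprod : deriv (discountedSeminorm N c a y) t = _ := (hexp.fun_mul hu').deriv
  calc deriv (discountedSeminorm N c a y) t
      = Real.exp (-(c * (t - a))) * (deriv (fun τ => N (y τ)) t - c * N (y t)) := by
        rw [hprod]; ring
    _ ≤ Real.exp (-(c * (t - a))) * N (q t) := by gcongr; linarith

theorem tendsto_integral_posPart_deriv {G g : ℕ → ℝ → ℝ} {B : ℝ → ℝ} (hab : a ≤ b)
    (hB : IntervalIntegrable B volume a b)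
    (hG : ∀ k, ∀ᵐ t, t ∈ Icc a b → deriv (G k) t ≤ g k t)
    (hgB : ∀ k, ∀ t ∈ Icc a b, |g k t| ≤ B t)
    (hg : ∀ t ∈ Icc a b, Tendsto (fun k => g k t) atTop (𝓝 0)) :
    Tendsto (fun k => ∫ t in a..b, max (deriv (G k) t) 0) atTop (𝓝 0) := by
  have hsub : uIoc a b ⊆ Icc a b := by rw [uIoc_of_le hab]; exact Ioc_subset_Icc_self
  suffices h : Tendsto (fun k => ∫ t in a..b, max (deriv (G k) t) 0) atTop
      (𝓝 (∫ _ in a..b, (0 : ℝ))) by simpa only [intervalIntegral.integral_zero] using h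
  refine intervalIntegral.tendsto_integral_filter_of_dominated_convergence B
    (Eventually.of_forall fun k =>
      ((measurable_deriv (G k)).max measurable_const).aestronglyMeasurable)
    (Eventually.of_forall fun k => (hG k).mono fun t h ht => ?_) hB
    ((ae_all_iff.2 hG).mono fun t h ht => ?_)
  · rw [Real.norm_of_nonneg (le_max_right _ _)]
    have hbound := hgB k t (hsub ht)
    exact max_le ((h (hsub ht)).trans ((le_abs_self _).trans hbound))
      ((abs_nonneg _).trans hbound)
  · have hg0 : Tendsto (fun k => max (g k t) 0) atTop (𝓝 0) := by
      simpa only [max_self] using (hg t (hsub ht)).max (tendsto_const_nhds (x := (0 : ℝ)))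
    exact squeeze_zero (fun k => le_max_right _ _)
      (fun k => max_le_max_right 0 (h k (hsub ht))) hg0

theorem eventually_seminorm_lt_of_perturbation_tendsto_zero (hN : LipschitzWith C N) (hab : a ≤ b)
    {A : ℝ → E →L[ℝ] E} (hA : ∀ t ∈ Icc a b, LogNormLE N (A t) c) {y q : ℕ → ℝ → E}
    {K : ℕ → ℝ≥0} (hy : ∀ k, LipschitzOnWith (K k) (y k) (Icc a b))
    (hd : ∀ k, ∀ᵐ t, t ∈ Icc a b → HasDerivAt (y k) (A t (y k t) + q k t) t) {D Λ Λ' : ℝ}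
    (hqD : ∀ k, ∀ t ∈ Icc a b, ‖q k t‖ ≤ D)
    (hq : ∀ t ∈ Icc a b, Tendsto (fun k => q k t) atTop (𝓝 0))
    (hΛ : ∀ k, N (y k a) ≤ Λ) (hΛ' : Real.exp (c * (b - a)) * Λ < Λ') :
    ∀ᶠ k in atTop, N (y k b) < Λ' := by
  have hlim : Tendsto (fun k => ∫ t in a..b, max (deriv (discountedSeminorm N c a (y k)) t) 0)
      atTop (𝓝 0) := by
    refine tendsto_integral_posPart_deriv (B := fun t => Real.exp (-(c * (t - a))) * (C * D)) hab
      (Continuous.intervalIntegrable (by fun_prop) _ _)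
      (fun k => ae_deriv_discountedSeminorm_le hN hab (hy k) hA (hd k))
      (fun k t ht => ?_) fun t ht => ?_
    · rw [abs_of_nonneg (by positivity)]
      gcongr
      exact (Real.le_norm_self _).trans <| (hN.norm_le_mul (map_zero N) _).trans <| by
        gcongr; exact hqD k t ht
    · have hNq : Tendsto (fun k => N (q k t)) atTop (𝓝 0) := by
        simpa only [map_zero, Function.comp_def] using (hN.continuous.tendsto 0).comp (hq t ht)
      simpa only [mul_zero] using hNq.const_mul (Real.exp (-(c * (t - a))))
  have hupper := (hlim.const_add Λ).const_mul (Real.exp (c * (b - a)))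
  rw [add_zero] at hupper
  filter_upwards [hupper.eventually_lt_const hΛ'] with k hk
  refine ((seminorm_le_exp_mul_add_integral (c := c) hab
    (absolutelyContinuousOnInterval_discountedSeminorm hN hab (hy k))).trans ?_).trans_lt hk
  gcongr
  exact hΛ k

end LogarithmicNorm

section Linearization

variable {E : Type*} [NormedAddCommGroup E] [NormedSpace ℝ E]

theorem IsSolution.ae_hasDerivAt [CompleteSpace E] {f : ℝ → E → E} {s : ℝ} {x : E} {φ : ℝ → E}
    (h : IsSolution f s x φ) (b : ℝ) :
    ∀ᵐ t, t ∈ Icc s b → HasDerivAt φ (f t (φ t)) t := by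
  rcases lt_or_ge b s with hb | hb
  · simp only [Icc_eq_empty_of_lt hb, mem_empty_iff_false, IsEmpty.forall_iff, eventually_true]
  have hprim := (h b hb).1.ae_hasDerivAt_integral
  have hne : ∀ᵐ t : ℝ, t ≠ s := by simp [ae_iff, measure_singleton]
  rw [uIcc_of_le hb] at hprim
  filter_upwards [hprim, hne] with t ht hts htb
  refine ((ht htb s (left_mem_Icc.2 hb)).const_add x).congr_of_eventuallyEq ?_
  filter_upwards [lt_mem_nhds (lt_of_le_of_ne htb.1 hts.symm)] with τ hτ
  exact (h τ hτ.le).2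

theorem IsSolution.lipschitzOnWith_sub {f : ℝ → E → E} {s b : ℝ} {x y : E} {φ ψ : ℝ → E}
    {K : ℝ≥0} (hφ : IsSolution f s x φ) (hψ : IsSolution f s y ψ)
    (hK : ∀ t ∈ Icc s b, ‖f t (φ t) - f t (ψ t)‖ ≤ K) :
    LipschitzOnWith K (fun t => φ t - ψ t) (Icc s b) := by
  refine LipschitzOnWith.of_dist_le_mul fun t ht τ hτ => ?_
  rw [dist_eq_norm, sub_sub_sub_comm, hφ.sub_eq_integral hτ.1 ht.1, hψ.sub_eq_integral hτ.1 ht.1,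
    ← intervalIntegral.integral_sub (hφ.intervalIntegrable hτ.1 ht.1)
      (hψ.intervalIntegrable hτ.1 ht.1)]
  exact intervalIntegral.norm_integral_le_of_norm_le_const fun r hr =>
    hK r (ordConnected_Icc.uIcc_subset hτ ht (uIoc_subset_uIcc hr))

theorem tendsto_inv_smul_fderiv_remainder {g : E → E} {A : E →L[ℝ] E} {x : E}
    (hg : HasFDerivAt g A x) {z : ℕ → E} {h : ℕ → ℝ} (hh : Tendsto h atTop (𝓝 0)) {M : ℝ}
    (hz : ∀ k, ‖z k - x‖ ≤ M * h k) :
    Tendsto (fun k => (h k)⁻¹ • (g (z k) - g x - A (z k - x))) atTop (𝓝 0) := by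
  have hzx : Tendsto z atTop (𝓝 x) := by
    refine tendsto_iff_norm_sub_tendsto_zero.2 (squeeze_zero (fun _ => norm_nonneg _) hz ?_)
    simpa only [mul_zero] using hh.const_mul M
  have hO : (fun k => z k - x) =O[atTop] h :=
    Asymptotics.IsBigO.of_bound |M| <| Eventually.of_forall fun k => by
      rw [Real.norm_eq_abs, ← abs_mul]
      exact (hz k).trans (le_abs_self _)
  exact ((hg.isLittleO.comp_tendsto hzx).trans_isBigO hO).tendsto_inv_smul_nhds_zero

theorem norm_fderiv_le_of_lipschitzOnWith_closedBall {g : E → E} {L : ℝ≥0} {R : ℝ} {x : E}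
    (hg : LipschitzOnWith L g (Metric.closedBall 0 (R + 1))) (hx : ‖x‖ ≤ R) :
    ‖fderiv ℝ g x‖ ≤ L :=
  norm_fderiv_le_of_lipschitzOn ℝ
    (Metric.closedBall_mem_nhds_of_mem (mem_ball_zero_iff.2 (hx.trans_lt (lt_add_one R)))) hg

theorem eventually_seminorm_sub_lt_of_isSolution [CompleteSpace E] {N : Seminorm ℝ E} {C : ℝ≥0}
    (hN : LipschitzWith C N) {f : ℝ → E → E} {a b c R : ℝ} (hab : a ≤ b) {L : ℝ≥0}
    (hf : ∀ t ∈ Icc a b, LipschitzOnWith L (f t) (Metric.closedBall 0 (R + 1))) {x : E}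
    {ψ : ℝ → E} (hψ : IsSolution f a x ψ) (hψR : ∀ t ∈ Icc a b, ‖ψ t‖ ≤ R)
    (hfd : ∀ t ∈ Icc a b, DifferentiableAt ℝ (f t) (ψ t))
    (hlog : ∀ t ∈ Icc a b, LogNormLE N (fderiv ℝ (f t) (ψ t)) c)
    {z : ℕ → E} {φ : ℕ → ℝ → E} (hφ : ∀ k, IsSolution f a (z k) (φ k))
    (hφR : ∀ k, ∀ t ∈ Icc a b, ‖φ k t‖ ≤ R) {h : ℕ → ℝ} (hh : ∀ k, 0 < h k)
    (hh0 : Tendsto h atTop (𝓝 0)) {M : ℝ≥0} (hM : ∀ k, ∀ t ∈ Icc a b, ‖φ k t - ψ t‖ ≤ M * h k)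
    {Λ Λ' : ℝ} (hΛ : ∀ k, N (z k - x) ≤ Λ * h k) (hΛ' : Real.exp (c * (b - a)) * Λ < Λ') :
    ∀ᶠ k in atTop, N (φ k b - ψ b) < Λ' * h k := by
  set A : ℝ → E →L[ℝ] E := fun t => fderiv ℝ (f t) (ψ t)
  have hdiff : ∀ k, ∀ t ∈ Icc a b, ‖f t (φ k t) - f t (ψ t)‖ ≤ L * (M * h k) := fun k t ht => by
    refine ((hf t ht).norm_sub_le ?_ ?_).trans (by gcongr; exact hM k t ht) <;>
      rw [mem_closedBall_zero_iff]
    exacts [by linarith [hφR k t ht], by linarith [hψR t ht]]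
  have hA : ∀ k, ∀ t ∈ Icc a b, ‖A t (φ k t - ψ t)‖ ≤ L * (M * h k) := fun k t ht =>
    (A t).le_of_opNorm_le_of_le
      (norm_fderiv_le_of_lipschitzOnWith_closedBall (hf t ht) (hψR t ht)) (hM k t ht)
  have hev := eventually_seminorm_lt_of_perturbation_tendsto_zero (C := C) (A := A) hN hab hlog
    (y := fun k t => (h k)⁻¹ • (φ k t - ψ t))
    (q := fun k t => (h k)⁻¹ • (f t (φ k t) - f t (ψ t) - A t (φ k t - ψ t)))
    (K := fun k => ‖(h k)⁻¹‖₊ * (L * (M * (h k).toNNReal))) (D := 2 * L * M) (Λ := Λ) (Λ' := Λ')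
    (fun k => (lipschitzWith_smul (h k)⁻¹).comp_lipschitzOnWith
      ((hφ k).lipschitzOnWith_sub hψ fun t ht => by
        simpa [Real.coe_toNNReal _ (hh k).le] using hdiff k t ht))
    (fun k => ?_) (fun k t ht => ?_)
    (fun t ht => tendsto_inv_smul_fderiv_remainder (hfd t ht).hasFDerivAt hh0 fun k => hM k t ht)
    (fun k => ?_) hΛ'
  · filter_upwards [hev] with k hk
    rwa [map_smul_eq_mul, norm_inv, Real.norm_of_nonneg (hh k).le, inv_mul_lt_iff₀ (hh k),
      mul_comm] at hk
  · filter_upwards [(hφ k).ae_hasDerivAt b, hψ.ae_hasDerivAt b] with t hφt hψt ht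
    refine (((hφt ht).fun_sub (hψt ht)).fun_const_smul (h k)⁻¹).congr_deriv ?_
    rw [map_smul, ← smul_add, add_sub_cancel]
  · rw [norm_smul, norm_inv, Real.norm_of_nonneg (hh k).le, inv_mul_le_iff₀ (hh k)]
    linarith [norm_sub_le (f t (φ k t) - f t (ψ t)) (A t (φ k t - ψ t)), hdiff k t ht, hA k t ht]
  · rw [map_smul_eq_mul, norm_inv, Real.norm_of_nonneg (hh k).le, inv_mul_le_iff₀ (hh k), mul_comm,
      (hφ k).apply_self, hψ.apply_self]
    exact hΛ k

theorem eventually_seminorm_flow_sub_le [ProperSpace E] {N : Seminorm ℝ E} {C : ℝ≥0}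
    (hN : LipschitzWith C N) {t₀ : ℝ} {f : ℝ → E → E} (hfc : ForwardComplete t₀ f)
    (hf : IsLocallyLipschitzFrom t₀ f) (hfd : ∀ t, t₀ ≤ t → Differentiable ℝ (f t))
    {s a b c : ℝ} (hs : t₀ ≤ s) (hsa : s ≤ a) (hab : a ≤ b) {S : Set E}
    (hS : Bornology.IsBounded S) {v : E} (hv : v ∈ S)
    (hlog : ∀ t ∈ Icc a b, LogNormLE N (fderiv ℝ (f t) (flow f t s v)) c) {Λ Λ' : ℝ}
    (hΛ : ∀ w ∈ S, N (flow f a s w - flow f a s v) ≤ Λ * ‖w - v‖)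
    (hΛ' : Real.exp (c * (b - a)) * Λ < Λ') :
    ∀ᶠ w in 𝓝[S] v, N (flow f b s w - flow f b s v) ≤ Λ' * ‖w - v‖ := by
  by_contra hfreq
  obtain ⟨w, hwv, hw⟩ := exists_seq_forall_of_frequently
    ((not_eventually.1 hfreq).and_eventually self_mem_nhdsWithin)
  have hpos : ∀ k, 0 < ‖w k - v‖ := fun k =>
    norm_pos_iff.2 <| sub_ne_zero.2 fun h => (hw k).1 (by simp [h])
  have hlim : Tendsto (fun k => ‖w k - v‖) atTop (𝓝 0) :=
    tendsto_iff_norm_sub_tendsto_zero.1 (tendsto_nhds_of_tendsto_nhdsWithin hwv)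
  obtain ⟨R, hR⟩ := hfc.exists_norm_flow_le hf hs b hS
  obtain ⟨L, hL⟩ := hf b (R + 1)
  obtain ⟨M, hM⟩ := hfc.exists_lipschitzOnWith_flow hf hs b hS
  have hsb : ∀ {t}, t ∈ Icc a b → t ∈ Icc s b := fun ht => ⟨hsa.trans ht.1, ht.2⟩
  have hsol : ∀ x, IsSolution f a (flow f a s x) (fun t => flow f t s x) := fun x =>
    (hfc.isSolution_flow hs x).restart hsa
  have hev := eventually_seminorm_sub_lt_of_isSolution hN hab
    (fun t ht => hL t ⟨hs.trans (hsb ht).1, ht.2⟩) (hsol v) (fun t ht => hR v hv t (hsb ht))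
    (fun t ht => (hfd t (hs.trans (hsb ht).1)).differentiableAt) hlog (fun k => hsol (w k))
    (fun k t ht => hR _ (hw k).2 t (hsb ht)) hpos hlim
    (fun k t ht => (hM t (hsb ht)).norm_sub_le (hw k).2 hv) (fun k => hΛ _ (hw k).2) hΛ'
  obtain ⟨k, hk⟩ := hev.exists
  exact (hw k).1 hk.le

theorem sub_le_mul_sub_of_eventually_abs_sub_le {u : ℝ → ℝ} {a b Λ : ℝ} (hab : a ≤ b)
    (h : ∀ σ ∈ Icc a b, ∀ Λ' > Λ, ∀ᶠ τ in 𝓝[Icc a b] σ, |u τ - u σ| ≤ Λ' * |τ - σ|) :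
    u b - u a ≤ Λ * (b - a) := by
  have hcont : ContinuousOn u (Icc a b) := by
    intro σ hσ
    refine tendsto_iff_norm_sub_tendsto_zero.2 (squeeze_zero' (Eventually.of_forall fun _ =>
      norm_nonneg _) (h σ hσ (Λ + 1) (lt_add_one Λ)) ?_)
    have hlim : Continuous fun τ => (Λ + 1) * |τ - σ| := by fun_prop
    simpa using (hlim.tendsto σ).mono_left nhdsWithin_le_nhds
  refine sub_le_iff_le_add'.2 <| image_le_of_liminf_slope_right_le_deriv_boundary (f := u)
    (a := a) (b := b) (B := fun σ => u a + Λ * (σ - a)) (B' := fun _ => Λ) hcont (by simp)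
    (by fun_prop)
    (fun σ _ => by
      simpa using ((((hasDerivAt_id σ).sub_const a).const_mul Λ).const_add (u a)).hasDerivWithinAt)
    (fun σ hσ Λ' hΛ' => Eventually.frequently ?_) (right_mem_Icc.2 hab)
  obtain ⟨Λ'', hΛ, hΛ''⟩ := exists_between hΛ'
  have hright : ∀ᶠ τ in 𝓝[>] σ, |u τ - u σ| ≤ Λ'' * |τ - σ| :=
    nhdsWithin_le_of_mem (Icc_mem_nhdsGT_of_mem hσ) (h σ (Ico_subset_Icc_self hσ) Λ'' hΛ)
  filter_upwards [hright, self_mem_nhdsWithin] with τ hτ (hστ : σ < τ)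
  rw [abs_of_pos (sub_pos.2 hστ)] at hτ
  rw [slope_def_field, div_lt_iff₀ (sub_pos.2 hστ)]
  exact ((le_abs_self _).trans hτ).trans_lt (mul_lt_mul_of_pos_right hΛ'' (sub_pos.2 hστ))

theorem seminorm_image_sub_le_of_convex {F : Type*} [AddCommGroup F] [Module ℝ F]
    {N : Seminorm ℝ F} {g : E → F} {S : Set E} (hS : Convex ℝ S) {Λ : ℝ}
    (h : ∀ v ∈ S, ∀ Λ' > Λ, ∀ᶠ w in 𝓝[S] v, N (g w - g v) ≤ Λ' * ‖w - v‖) {v w : E}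
    (hv : v ∈ S) (hw : w ∈ S) : N (g v - g w) ≤ Λ * ‖v - w‖ := by
  let γ : ℝ →ᵃ[ℝ] E := AffineMap.lineMap w v
  let u : ℝ → ℝ := fun σ => N (g (γ σ) - g w)
  suffices hu : u 1 - u 0 ≤ Λ * ‖v - w‖ * (1 - 0) by simpa [u, γ] using hu
  refine sub_le_mul_sub_of_eventually_abs_sub_le zero_le_one fun σ hσ ρ hρ => ?_
  have hγS : MapsTo γ (Icc 0 1) S := fun σ hσ => hS.lineMap_mem hw hv hσ
  have hγ : Tendsto γ (𝓝[Icc 0 1] σ) (𝓝[S] γ σ) :=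
    AffineMap.lineMap_continuous.continuousWithinAt.tendsto_nhdsWithin hγS
  have hscale : Continuous fun Λ' => Λ' * ‖v - w‖ := by fun_prop
  obtain ⟨Λ', hΛ', hΛ'ρ⟩ := ((hscale.tendsto Λ).eventually_lt_const hρ).exists_gt
  filter_upwards [hγ.eventually (h _ (hγS hσ) Λ' hΛ')] with τ hτ
  calc |u τ - u σ| ≤ N (g (γ τ) - g w - (g (γ σ) - g w)) := abs_sub_map_le_sub N _ _
    _ = N (g (γ τ) - g (γ σ)) := by rw [sub_sub_sub_cancel_right]
    _ ≤ Λ' * ‖γ τ - γ σ‖ := hτ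
    _ = Λ' * ‖v - w‖ * |τ - σ| := by
      rw [← dist_eq_norm, dist_lineMap_lineMap, Real.dist_eq, dist_comm, dist_eq_norm]
      ring
    _ ≤ ρ * |τ - σ| := by gcongr

theorem seminorm_flow_sub_le_exp_mul [ProperSpace E] {N : Seminorm ℝ E} {C : ℝ≥0}
    (hN : LipschitzWith C N) {t₀ : ℝ} {f : ℝ → E → E} (hfc : ForwardComplete t₀ f)
    (hf : IsLocallyLipschitzFrom t₀ f) (hfd : ∀ t, t₀ ≤ t → Differentiable ℝ (f t))
    {s a b c : ℝ} (hs : t₀ ≤ s) (hsa : s ≤ a) (hab : a ≤ b) {S : Set E}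
    (hS : Bornology.IsBounded S) (hSc : Convex ℝ S)
    (hlog : ∀ t ∈ Icc a b, ∀ v ∈ S, LogNormLE N (fderiv ℝ (f t) (flow f t s v)) c) {Λ : ℝ}
    (hΛ : ∀ v ∈ S, ∀ w ∈ S, N (flow f a s v - flow f a s w) ≤ Λ * ‖v - w‖) {v w : E}
    (hv : v ∈ S) (hw : w ∈ S) :
    N (flow f b s v - flow f b s w) ≤ Real.exp (c * (b - a)) * Λ * ‖v - w‖ :=
  seminorm_image_sub_le_of_convex hSc
    (fun x hx _ hΛ' => eventually_seminorm_flow_sub_le hN hfc hf hfd hs hsa hab hS hx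
      (fun t ht => hlog t ht x hx) (fun y hy => hΛ y hy x hx) hΛ') hv hw

end Linearization

section Covering

variable {E : Type*} [NormedAddCommGroup E] [NormedSpace ℝ E]

theorem encard_le_of_isSeparated_of_norm_le [FiniteDimensional ℝ E] {C : Set E} {R : ℝ}
    {δ : ℝ≥0} (hC : ∀ x ∈ C, ‖x‖ ≤ R) (hR : 0 ≤ R) (hδ : 0 < δ) (hsep : Metric.IsSeparated δ C) :
    (C.encard : ENNReal) ≤ ENNReal.ofReal ((1 + 2 * R / δ) ^ Module.finrank ℝ E) := by
  borelize E
  set μ : Measure E := Measure.addHaar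
  set d := Module.finrank ℝ E
  have hδ' : (0 : ℝ) < δ := hδ
  have hdisj : Pairwise (Function.onFun Disjoint fun x : C => Metric.ball (x : E) (δ / 2)) :=
    fun x y hxy => Metric.ball_disjoint_ball <| by
      have h : (δ : ENNReal) < edist (x : E) y := hsep x.2 y.2 (Subtype.coe_injective.ne hxy)
      rw [edist_nndist, ENNReal.coe_lt_coe] at h
      rw [add_halves, ← coe_nndist]
      exact_mod_cast h.le
  have hsub : (⋃ x : C, Metric.ball (x : E) (δ / 2)) ⊆ Metric.closedBall 0 (R + δ / 2) :=
    iUnion_subset fun x => Metric.ball_subset_closedBall.trans <|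
      Metric.closedBall_subset_closedBall' <| by
        rw [dist_zero_right]
        linarith [hC x x.2]
  have hvol : (C.encard : ENNReal) * (ENNReal.ofReal ((δ / 2 : ℝ) ^ d) * μ (Metric.ball 0 1)) ≤
      ENNReal.ofReal ((1 + 2 * R / δ) ^ d) *
        (ENNReal.ofReal ((δ / 2 : ℝ) ^ d) * μ (Metric.ball 0 1)) := by
    calc _ = ∑' x : C, μ (Metric.ball (x : E) (δ / 2)) := by
          simp_rw [μ.addHaar_ball_of_pos _ (half_pos hδ')]
          rw [ENNReal.tsum_const, encard]
      _ ≤ μ (⋃ x : C, Metric.ball (x : E) (δ / 2)) :=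
          tsum_meas_le_meas_iUnion_of_disjoint μ (fun _ => measurableSet_ball) hdisj
      _ ≤ μ (Metric.closedBall 0 (R + δ / 2)) := measure_mono hsub
      _ = _ := by
          rw [μ.addHaar_closedBall _ (by positivity), ← mul_assoc,
            ← ENNReal.ofReal_mul (by positivity), ← mul_pow]
          congr 3
          field_simp
          ring
  have h0 : ENNReal.ofReal ((δ / 2 : ℝ) ^ d) * μ (Metric.ball 0 1) ≠ 0 :=
    mul_ne_zero (ENNReal.ofReal_pos.2 (by positivity)).ne' (Metric.measure_ball_pos μ _ one_pos).ne'
  exact (ENNReal.mul_le_mul_iff_left h0 (ENNReal.mul_ne_top ENNReal.ofReal_ne_top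
    measure_ball_lt_top.ne)).1 hvol

theorem coveringNumber_le_of_norm_le [FiniteDimensional ℝ E] {K : Set E} {R : ℝ} {δ : ℝ≥0}
    (hK : ∀ x ∈ K, ‖x‖ ≤ R) (hR : 0 ≤ R) (hδ : 0 < δ) :
    (Metric.coveringNumber δ K : ENNReal) ≤
      ENNReal.ofReal ((1 + 2 * R / δ) ^ Module.finrank ℝ E) := by
  refine (ENat.toENNReal_le.2 (Metric.coveringNumber_le_packingNumber δ K)).trans ?_
  simp only [Metric.packingNumber, ENat.toENNReal_iSup, iSup_le_iff]
  exact fun C hCK hsep =>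
    encard_le_of_isSeparated_of_norm_le (fun x hx => hK x (hCK hx)) hR hδ hsep

end Covering

section Entropy

variable {E : Type*} [NormedAddCommGroup E] [NormedSpace ℝ E] {p : Seminorm ℝ E}
  {f : ℝ → E → E} {t₀ : ℝ} {K : Set E}

theorem spanningNumber_anti (p : Seminorm ℝ E) (f : ℝ → E → E) (t₀ T : ℝ) (K : Set E) :
    Antitone fun ε => spanningNumber p f t₀ ε T K := by
  refine fun ε ε' h => le_iInf₂ fun A hA => iInf₂_le A ⟨hA.1, fun y hy => ?_⟩
  obtain ⟨x, hx, hlt⟩ := hA.2 y hy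
  exact ⟨x, hx, fun t ht => (hlt t ht).trans_le h⟩

theorem topEntropy_le {B : EReal}
    (h : ∀ ε : ℝ, 0 < ε → limsup (fun T : ℝ => ((1 / T : ℝ) : EReal) *
      ENNReal.log ((spanningNumber p f t₀ ε T K : ℕ∞) : ENNReal)) atTop ≤ B) :
    topEntropy p f t₀ K ≤ B := by
  have hanti : Antitone fun ε : ℝ => limsup (fun T : ℝ => ((1 / T : ℝ) : EReal) *
      ENNReal.log ((spanningNumber p f t₀ ε T K : ℕ∞) : ENNReal)) atTop := fun ε ε' hε => by
    refine limsup_le_limsup ?_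
    filter_upwards [eventually_ge_atTop (0 : ℝ)] with T hT
    exact mul_le_mul_of_nonneg_left
      (ENNReal.log_monotone (ENat.toENNReal_le.2 (spanningNumber_anti p f t₀ T K hε)))
      (EReal.coe_nonneg.2 (one_div_nonneg.2 hT))
  rw [topEntropy, (hanti.tendsto_nhdsGT 0).limUnder_eq]
  exact sSup_le (forall_mem_image.2 h)

theorem limsup_one_div_mul_le {g : ℝ → EReal} {B r : ℝ}
    (hg : ∀ᶠ T in atTop, g T ≤ ((B + r * T : ℝ) : EReal)) :
    limsup (fun T : ℝ => ((1 / T : ℝ) : EReal) * g T) atTop ≤ (r : EReal) := by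
  have hlim : Tendsto (fun T : ℝ => ((B * T⁻¹ + r : ℝ) : EReal)) atTop (𝓝 (r : EReal)) :=
    EReal.tendsto_coe.2 (by simpa using (tendsto_inv_atTop_zero.const_mul B).add_const r)
  rw [← hlim.limsup_eq]
  refine limsup_le_limsup ?_
  filter_upwards [hg, eventually_gt_atTop 0] with T hgT hT
  calc _ ≤ ((1 / T : ℝ) : EReal) * ((B + r * T : ℝ) : EReal) :=
        mul_le_mul_of_nonneg_left hgT (EReal.coe_nonneg.2 (one_div_nonneg.2 hT.le))
    _ = ((B * T⁻¹ + r : ℝ) : EReal) := by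
        rw [← EReal.coe_mul]
        congr 1
        field_simp

theorem spanningNumber_le_coveringNumber {ε T Λ : ℝ} {δ : ℝ≥0} (hΛ : 0 ≤ Λ) (hε : Λ * δ < ε)
    (h : ∀ t ∈ Icc t₀ (t₀ + T), ∀ x ∈ K, ∀ y ∈ K,
      p (flow f t t₀ x - flow f t t₀ y) ≤ Λ * ‖x - y‖) :
    spanningNumber p f t₀ ε T K ≤ Metric.coveringNumber δ K := by
  refine le_iInf₂ fun A hAK => le_iInf fun hA => iInf₂_le A ⟨hAK, fun y hy => ?_⟩
  obtain ⟨x, hx, hyx⟩ := mem_iUnion₂.1 (Metric.isCover_iff_subset_iUnion_closedBall.1 hA hy)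
  rw [mem_closedBall_iff_norm] at hyx
  exact ⟨x, hx, fun t ht => ((h t ht y hy x (hAK hx)).trans
    (mul_le_mul_of_nonneg_left hyx hΛ)).trans_lt hε⟩

theorem log_spanningNumber_le [FiniteDimensional ℝ E] {D : ℝ≥0} {R c ε T : ℝ} (hR : 0 ≤ R)
    (hK : ∀ x ∈ K, ‖x‖ ≤ R) (hc : 0 ≤ c) (hε : 0 < ε) (hT : 0 ≤ T)
    (h : ∀ t, t₀ ≤ t → ∀ x ∈ K, ∀ y ∈ K,
      p (flow f t t₀ x - flow f t t₀ y) ≤ D * Real.exp (c * (t - t₀)) * ‖x - y‖) :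
    ENNReal.log ((spanningNumber p f t₀ ε T K : ℕ∞) : ENNReal) ≤
      ((Module.finrank ℝ E * Real.log (1 + 2 * R * (D + 1) / ε) +
        Module.finrank ℝ E * c * T : ℝ) : EReal) := by
  set d := Module.finrank ℝ E
  set Q := 2 * R * (D + 1) / ε with hQ
  have hQ0 : 0 ≤ Q := by positivity
  set e := Real.exp (c * T) with he
  have he0 : 0 < e := Real.exp_pos _
  have hδ : 0 < ε / ((D + 1) * e) := by positivity
  lift ε / ((D + 1) * e) to ℝ≥0 using hδ.le with δ hδe
  have hspan : spanningNumber p f t₀ ε T K ≤ Metric.coveringNumber δ K := by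
    refine spanningNumber_le_coveringNumber (Λ := D * e) (by positivity) ?_
      fun t ht x hx y hy => (h t ht.1 x hx y hy).trans ?_
    · rw [hδe, mul_div_left_comm, mul_div_mul_right _ _ he0.ne']
      exact mul_lt_of_lt_one_right hε ((div_lt_one (by positivity)).2 (lt_add_one _))
    · have hexp : Real.exp (c * (t - t₀)) ≤ e := by
        rw [he]
        gcongr
        linarith [ht.2]
      gcongr
  have hcover : (Metric.coveringNumber δ K : ENNReal) ≤ ENNReal.ofReal (((1 + Q) * e) ^ d) := by
    refine (coveringNumber_le_of_norm_le hK hR hδ).trans (ENNReal.ofReal_le_ofReal ?_)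
    have hbase : 1 + 2 * R / δ = 1 + Q * e := by
      rw [hδe, hQ]
      field_simp
    have he1 : 1 ≤ e := Real.one_le_exp (by positivity)
    gcongr
    linarith
  calc _ ≤ ENNReal.log (ENNReal.ofReal (((1 + Q) * e) ^ d)) :=
        ENNReal.log_monotone ((ENat.toENNReal_le.2 hspan).trans hcover)
    _ = _ := by
        rw [ENNReal.log_ofReal_of_pos (by positivity), Real.log_pow,
          Real.log_mul (by positivity) he0.ne', he, Real.log_exp]
        congr 1
        ring

theorem topEntropy_le_finrank_mul [FiniteDimensional ℝ E] (hK : Bornology.IsBounded K)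
    {D : ℝ≥0} {c : ℝ} (hc : 0 ≤ c)
    (h : ∀ t, t₀ ≤ t → ∀ x ∈ K, ∀ y ∈ K,
      p (flow f t t₀ x - flow f t t₀ y) ≤ D * Real.exp (c * (t - t₀)) * ‖x - y‖) :
    topEntropy p f t₀ K ≤ ((Module.finrank ℝ E * c : ℝ) : EReal) := by
  obtain ⟨R, hR0, hR⟩ := hK.exists_pos_norm_le
  exact topEntropy_le fun ε hε => limsup_one_div_mul_le <|
    (eventually_ge_atTop 0).mono fun T hT => log_spanningNumber_le hR0.le hR hc hε hT h

end Entropy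

section FiniteDimension

theorem continuous_seminorm {V : Type*} [NormedAddCommGroup V] [NormedSpace ℝ V]
    [FiniteDimensional ℝ V] (p : Seminorm ℝ V) : Continuous p :=
  p.convexOn.locallyLipschitz.continuous

theorem IsNorm.exists_seminorm_le {V : Type*} [AddCommGroup V] [Module ℝ V]
    [FiniteDimensional ℝ V] {N : Seminorm ℝ V} (hN : IsNorm N) (p : Seminorm ℝ V) :
    ∃ C : ℝ≥0, ∀ x, p x ≤ C * N x := by
  -- `N` turns `V` into a finite-dimensional normed space, on which `p` is continuous.
  let _ : NormedAddCommGroup V := AddGroupNorm.toNormedAddCommGroup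
    { N with eq_zero_of_map_eq_zero' := hN }
  let _ : NormedSpace ℝ V := ⟨fun a x => (map_smul_eq_mul N a x).le⟩
  obtain ⟨C, hC, hpC⟩ := p.bound_of_continuous_normedSpace (continuous_seminorm p)
  exact ⟨⟨C, hC.le⟩, hpC⟩

end FiniteDimension

section MatrixMeasure

variable {ι κ : Type*} [Fintype κ] {p : Seminorm ℝ (ι → ℝ)} {q : Seminorm ℝ (κ → ℝ)}
  {A : Matrix ι κ ℝ}

theorem bddAbove_seminorm_mulVec (p : Seminorm ℝ (ι → ℝ)) (hq : IsNorm q) (A : Matrix ι κ ℝ) :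
    BddAbove {r : ℝ | ∃ v : κ → ℝ, q v = 1 ∧ p (A.mulVec v) = r} := by
  obtain ⟨C, hC⟩ := hq.exists_seminorm_le (p.comp A.mulVecLin)
  refine ⟨C, ?_⟩
  rintro _ ⟨v, hv, rfl⟩
  exact (hC v).trans_eq (by rw [hv, mul_one])

theorem seminorm_mulVec_le (p : Seminorm ℝ (ι → ℝ)) (hq : IsNorm q) (A : Matrix ι κ ℝ)
    (v : κ → ℝ) : p (A.mulVec v) ≤ inducedNorm p q A * q v := by
  rcases eq_or_ne v 0 with rfl | hv
  · simp
  have hpos : 0 < q v := (apply_nonneg q v).lt_of_ne fun h => hv (hq v h.symm)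
  have hunit : q ((q v)⁻¹ • v) = 1 := by
    rw [map_smul_eq_mul, Real.norm_of_nonneg (inv_nonneg.2 hpos.le), inv_mul_cancel₀ hpos.ne']
  have hle := le_csSup (bddAbove_seminorm_mulVec p hq A) ⟨(q v)⁻¹ • v, hunit, rfl⟩
  rw [Matrix.mulVec_smul, map_smul_eq_mul, Real.norm_of_nonneg (inv_nonneg.2 hpos.le),
    inv_mul_le_iff₀ hpos, mul_comm] at hle
  exact hle

theorem inducedNorm_le {r : ℝ} (hr : 0 ≤ r) (h : ∀ v, q v = 1 → p (A.mulVec v) ≤ r) :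
    inducedNorm p q A ≤ r := by
  refine Real.sSup_le ?_ hr
  rintro _ ⟨v, hv, rfl⟩
  exact h v hv

theorem inducedNorm_nonneg (p : Seminorm ℝ (ι → ℝ)) (q : Seminorm ℝ (κ → ℝ))
    (A : Matrix ι κ ℝ) : 0 ≤ inducedNorm p q A := by
  refine Real.sSup_nonneg ?_
  rintro _ ⟨v, -, rfl⟩
  exact apply_nonneg p _

theorem inducedNorm_add_le (p : Seminorm ℝ (ι → ℝ)) (hq : IsNorm q) (A B : Matrix ι κ ℝ) :
    inducedNorm p q (A + B) ≤ inducedNorm p q A + inducedNorm p q B := by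
  refine inducedNorm_le (add_nonneg (inducedNorm_nonneg p q A) (inducedNorm_nonneg p q B))
    fun v hv => ?_
  have hA := seminorm_mulVec_le p hq A v
  have hB := seminorm_mulVec_le p hq B v
  rw [hv, mul_one] at hA hB
  rw [Matrix.add_mulVec]
  exact (map_add_le_add p _ _).trans (add_le_add hA hB)

theorem inducedNorm_smul_le (p : Seminorm ℝ (ι → ℝ)) (hq : IsNorm q) (a : ℝ) (A : Matrix ι κ ℝ) :
    inducedNorm p q (a • A) ≤ ‖a‖ * inducedNorm p q A := by
  refine inducedNorm_le (mul_nonneg (norm_nonneg a) (inducedNorm_nonneg p q A)) fun v hv => ?_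
  have hA := seminorm_mulVec_le p hq A v
  rw [hv, mul_one] at hA
  rw [Matrix.smul_mulVec, map_smul_eq_mul]
  gcongr

theorem convexOn_inducedNorm (p : Seminorm ℝ (ι → ℝ)) (hq : IsNorm q) :
    ConvexOn ℝ univ (inducedNorm p q) := by
  refine ⟨convex_univ, fun A _ B _ a b ha hb _ => ?_⟩
  refine (inducedNorm_add_le p hq _ _).trans (add_le_add ?_ ?_)
  · simpa only [Real.norm_of_nonneg ha, smul_eq_mul] using inducedNorm_smul_le p hq a A
  · simpa only [Real.norm_of_nonneg hb, smul_eq_mul] using inducedNorm_smul_le p hq b B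

theorem IsNorm.exists_eq_one {V : Type*} [AddCommGroup V] [Module ℝ V] [Nontrivial V]
    {q : Seminorm ℝ V} (hq : IsNorm q) : ∃ v, q v = 1 := by
  obtain ⟨w, hw⟩ := exists_ne (0 : V)
  have hpos : 0 < q w := (apply_nonneg q w).lt_of_ne fun h => hw (hq w h.symm)
  exact ⟨(q w)⁻¹ • w, by
    rw [map_smul_eq_mul, Real.norm_of_nonneg (inv_nonneg.2 hpos.le), inv_mul_cancel₀ hpos.ne']⟩

theorem inducedNorm_one [DecidableEq κ] [Nonempty κ] (hq : IsNorm q) :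
    inducedNorm q q 1 = 1 := by
  obtain ⟨v, hv⟩ := hq.exists_eq_one
  refine le_antisymm (inducedNorm_le zero_le_one fun w hw => by rw [Matrix.one_mulVec, hw]) ?_
  have hle := seminorm_mulVec_le q hq 1 v
  rwa [Matrix.one_mulVec, hv, mul_one] at hle

theorem tendsto_matrixMeasure [DecidableEq κ] [Nonempty κ] (hq : IsNorm q) (A : Matrix κ κ ℝ) :
    Tendsto (fun t : ℝ => (inducedNorm q q (1 + t • A) - 1) / t) (𝓝[>] 0)
      (𝓝 (matrixMeasure q A)) := by
  have hconv : ConvexOn ℝ univ fun t : ℝ => inducedNorm q q (1 + t • A) := by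
    simpa [Function.comp_def, AffineMap.lineMap_apply, add_comm] using
      (convexOn_inducedNorm q hq).comp_affineMap (AffineMap.lineMap (1 : Matrix κ κ ℝ) (1 + A))
  have hslope := (hasDerivWithinAt_iff_tendsto_slope' self_notMem_Ioi).1
    (hconv.differentiableWithinAt_Ioi_of_mem_interior (x := 0) (by simp)).hasDerivWithinAt
  have hquot : slope (fun t : ℝ => inducedNorm q q (1 + t • A)) 0 =
      fun t => (inducedNorm q q (1 + t • A) - 1) / t := by
    ext t
    rw [slope_def_field, zero_smul, add_zero, inducedNorm_one hq, sub_zero]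
  rw [hquot] at hslope
  rwa [matrixMeasure, hslope.limUnder_eq]

theorem eventually_inducedNorm_le [DecidableEq κ] [Nonempty κ] (hq : IsNorm q) (A : Matrix κ κ ℝ)
    {ε : ℝ} (hε : 0 < ε) :
    ∀ᶠ s : ℝ in 𝓝[>] 0, inducedNorm q q (1 + s • A) ≤ 1 + s * (matrixMeasure q A + ε) := by
  filter_upwards [(tendsto_matrixMeasure hq A).eventually_lt_const (lt_add_of_pos_right _ hε),
    self_mem_nhdsWithin] with s hlt hs
  rw [div_lt_iff₀ hs] at hlt
  linarith

end MatrixMeasure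

section Interconnected

variable {m : ℕ} {n : Fin m → ℕ} {net : Seminorm ℝ (Fin m → ℝ)} {hmono : IsMonotoneNorm net}
  {loc : (i : Fin m) → Seminorm ℝ (Fin (n i) → ℝ)} {f : ℝ → State n → State n} {t : ℝ}

/-- The norm `x ↦ |(|x₁|₁, …, |xₘ|ₘ)|_N` on the state space, in which the interconnection is
analysed. Monotonicity of the network norm is what makes it subadditive. -/
def aggregateSeminorm (net : Seminorm ℝ (Fin m → ℝ)) (hmono : IsMonotoneNorm net)
    (loc : (i : Fin m) → Seminorm ℝ (Fin (n i) → ℝ)) : Seminorm ℝ (State n) :=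
  Seminorm.of (fun x => net fun i => loc i (x i))
    (fun x y => (hmono ((fun i => loc i (x i)) + fun i => loc i (y i)) _
      (fun i => apply_nonneg (loc i) _) fun i => map_add_le_add (loc i) (x i) (y i)).trans
        (map_add_le_add net _ _))
    fun a x => by
      have : (fun i => loc i ((a • x) i)) = ‖a‖ • fun i => loc i (x i) := by
        ext i
        simp [map_smul_eq_mul]
      rw [this, map_smul_eq_mul, norm_norm]

theorem aggregateSeminorm_apply (x : State n) :
    aggregateSeminorm net hmono loc x = net fun i => loc i (x i) := rfl

theorem isNorm_aggregateSeminorm (hnet : IsNorm net) (hloc : ∀ i, IsNorm (loc i)) :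
    IsNorm (aggregateSeminorm net hmono loc) :=
  fun _ hx => funext fun i => hloc i _ (congrFun (hnet _ hx) i)

theorem jacobianBlock_mulVec (f : ℝ → State n → State n) (t : ℝ) (x : State n) (i j : Fin m)
    (w : Fin (n j) → ℝ) :
    (jacobianBlock f t x i j).mulVec w = fderiv ℝ (f t) x (Pi.single j w) i := by
  let L : (Fin (n j) → ℝ) →ₗ[ℝ] Fin (n i) → ℝ :=
    LinearMap.proj i ∘ₗ (fderiv ℝ (f t) x : State n →ₗ[ℝ] State n) ∘ₗ
      LinearMap.single ℝ (fun j => Fin (n j) → ℝ) j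
  exact LinearMap.toMatrix'_mulVec L w

theorem fderiv_apply_eq_sum_jacobianBlock (f : ℝ → State n → State n) (t : ℝ) (x z : State n)
    (i : Fin m) : fderiv ℝ (f t) x z i = ∑ j, (jacobianBlock f t x i j).mulVec (z j) := by
  simp_rw [jacobianBlock_mulVec]
  rw [← Finset.sum_apply, ← map_sum, Finset.univ_sum_single]

theorem seminorm_add_smul_fderiv_apply_le (hloc : ∀ i, IsNorm (loc i)) {s η : ℝ} (hs : 0 ≤ s)
    {x : State n} (z : State n) {i : Fin m}
    (hdiag : inducedNorm (loc i) (loc i) (1 + s • jacobianBlock f t x i i) ≤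
      1 + s * (matrixMeasure (loc i) (jacobianBlock f t x i i) + η)) :
    loc i ((z + s • fderiv ℝ (f t) x z) i) ≤
      ((1 + s • interconnectionMatrix loc f t x).mulVec (fun j => loc j (z j)) +
        (s * η) • fun j => loc j (z j)) i := by
  set A := interconnectionMatrix loc f t x
  have hsplit : (z + s • fderiv ℝ (f t) x z) i =
      (1 + s • jacobianBlock f t x i i).mulVec (z i) +
        s • ∑ j ∈ Finset.univ.erase i, (jacobianBlock f t x i j).mulVec (z j) := by
    rw [Pi.add_apply, Pi.smul_apply, fderiv_apply_eq_sum_jacobianBlock,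
      ← Finset.add_sum_erase _ _ (Finset.mem_univ i), smul_add, Matrix.add_mulVec,
      Matrix.one_mulVec, Matrix.smul_mulVec, add_assoc]
  have hself : loc i ((1 + s • jacobianBlock f t x i i).mulVec (z i)) ≤
      (1 + s * (A i i + η)) * loc i (z i) := by
    have hAii : A i i = matrixMeasure (loc i) (jacobianBlock f t x i i) := if_pos rfl
    rw [hAii]
    exact (seminorm_mulVec_le (loc i) (hloc i) _ _).trans
      (mul_le_mul_of_nonneg_right hdiag (apply_nonneg _ _))
  have hothers : loc i (∑ j ∈ Finset.univ.erase i, (jacobianBlock f t x i j).mulVec (z j)) ≤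
      ∑ j ∈ Finset.univ.erase i, A i j * loc j (z j) := by
    refine (Finset.le_sum_of_subadditive (loc i) (map_zero _).le (map_add_le_add _) _ _).trans
      (Finset.sum_le_sum fun j hj => ?_)
    have hAij : A i j = inducedNorm (loc i) (loc j) (jacobianBlock f t x i j) :=
      if_neg (Finset.ne_of_mem_erase hj).symm
    rw [hAij]
    exact seminorm_mulVec_le (loc i) (hloc j) _ _
  calc loc i ((z + s • fderiv ℝ (f t) x z) i)
      ≤ (1 + s * (A i i + η)) * loc i (z i) +
          s * ∑ j ∈ Finset.univ.erase i, A i j * loc j (z j) := by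
        rw [hsplit]
        refine (map_add_le_add (loc i) _ _).trans (add_le_add hself ?_)
        rw [map_smul_eq_mul, Real.norm_of_nonneg hs]
        gcongr
    _ = _ := by
        rw [Pi.add_apply, Matrix.add_mulVec, Matrix.one_mulVec, Matrix.smul_mulVec, Pi.add_apply,
          Pi.smul_apply, Pi.smul_apply, Matrix.mulVec, dotProduct,
          ← Finset.add_sum_erase _ _ (Finset.mem_univ i), smul_eq_mul, smul_eq_mul]
        ring

theorem logNormLE_aggregateSeminorm [NeZero m] [∀ i, NeZero (n i)] (hnet : IsNorm net)
    (hmono : IsMonotoneNorm net) (hloc : ∀ i, IsNorm (loc i)) {c : ℝ} {x : State n}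
    (hc : matrixMeasure net (interconnectionMatrix loc f t x) ≤ c) :
    LogNormLE (aggregateSeminorm net hmono loc) (fderiv ℝ (f t) x) c := by
  intro z ε hε
  set ζ : Fin m → ℝ := fun i => loc i (z i)
  have hζ : 0 ≤ net ζ := apply_nonneg net _
  set A := interconnectionMatrix loc f t x
  obtain ⟨η, hη, hηε⟩ : ∃ η > 0, 2 * η * net ζ ≤ ε := by
    refine ⟨ε / (2 * (net ζ + 1)), by positivity, ?_⟩
    rw [mul_div_assoc', mul_div_mul_left _ _ two_ne_zero, div_mul_eq_mul_div,
      div_le_iff₀ (by positivity)]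
    gcongr
    linarith
  filter_upwards [eventually_inducedNorm_le hnet A hη,
    eventually_all.2 fun i => eventually_inducedNorm_le (hloc i) (jacobianBlock f t x i i) hη,
    self_mem_nhdsWithin] with s hnets hlocs (hs : 0 < s)
  have hA : net ((1 + s • A).mulVec ζ) ≤ (1 + s * (c + η)) * net ζ := by
    refine (seminorm_mulVec_le net hnet _ _).trans (mul_le_mul_of_nonneg_right ?_ hζ)
    exact hnets.trans (by gcongr)
  rw [aggregateSeminorm_apply, aggregateSeminorm_apply]
  calc net (fun i => loc i ((z + s • fderiv ℝ (f t) x z) i))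
      ≤ net ((1 + s • A).mulVec ζ + (s * η) • ζ) :=
        hmono _ _ (fun i => apply_nonneg (loc i) _)
          fun i => seminorm_add_smul_fderiv_apply_le hloc hs.le z (hlocs i)
    _ ≤ net ((1 + s • A).mulVec ζ) + s * η * net ζ := by
        refine (map_add_le_add net _ _).trans_eq ?_
        rw [map_smul_eq_mul, Real.norm_of_nonneg (mul_pos hs hη).le]
    _ ≤ net ζ + s * (c * net ζ + 2 * η * net ζ) := by linarith
    _ ≤ net ζ + s * (c * net ζ + ε) := by gcongr

end Interconnected

section EntropyBound

variable {E : Type*} [NormedAddCommGroup E] [NormedSpace ℝ E] [FiniteDimensional ℝ E]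
  {f : ℝ → E → E} {t₀ t₁ a c : ℝ} {K : Set E} {N : Seminorm ℝ E}

theorem exists_seminorm_flow_sub_le_exp_mul (hfc : ForwardComplete t₀ f)
    (hf : IsLocallyLipschitzFrom t₀ f) (hfd : ∀ t, t₀ ≤ t → Differentiable ℝ (f t))
    (hK : Bornology.IsBounded K) (ht₁ : t₀ ≤ t₁) (ha : t₁ ≤ a)
    (hlog : ∀ t, a ≤ t → ∀ v ∈ convexHull ℝ (reachableSet f t₁ t₀ K),
      LogNormLE N (fderiv ℝ (f t) (flow f t t₁ v)) c) :
    ∃ D : ℝ≥0, ∀ t, a ≤ t → ∀ x ∈ K, ∀ y ∈ K,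
      N (flow f t t₀ x - flow f t t₀ y) ≤ D * Real.exp (c * (t - a)) * ‖x - y‖ := by
  have : ProperSpace E := FiniteDimensional.proper_real E
  obtain ⟨C, hNC⟩ := exists_lipschitzWith_seminorm (continuous_seminorm N)
  obtain ⟨M, hM⟩ := hfc.exists_lipschitzOnWith_flow hf le_rfl t₁ hK
  have hMt₁ : LipschitzOnWith M (flow f t₁ t₀) K := hM t₁ (right_mem_Icc.2 ht₁)
  set S := convexHull ℝ (reachableSet f t₁ t₀ K)
  obtain ⟨R, hR⟩ := hfc.exists_norm_flow_le hf le_rfl t₁ hK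
  have hS : Bornology.IsBounded S := isBounded_convexHull.2 <| isBounded_iff_forall_norm_le.2
    ⟨R, forall_mem_image.2 fun x hx => hR x hx t₁ (right_mem_Icc.2 ht₁)⟩
  obtain ⟨M', hM'⟩ := hfc.exists_lipschitzOnWith_flow hf ht₁ a hS
  have hmem : ∀ x ∈ K, flow f t₁ t₀ x ∈ S := fun x hx =>
    subset_convexHull ℝ _ (mem_image_of_mem _ hx)
  refine ⟨C * M' * M, fun t ht x hx y hy => ?_⟩
  calc N (flow f t t₀ x - flow f t t₀ y)
      = N (flow f t t₁ (flow f t₁ t₀ x) - flow f t t₁ (flow f t₁ t₀ y)) := by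
        rw [hfc.flow_flow hf le_rfl ht₁ (ha.trans ht), hfc.flow_flow hf le_rfl ht₁ (ha.trans ht)]
    _ ≤ Real.exp (c * (t - a)) * (C * M' : ℝ≥0) * ‖flow f t₁ t₀ x - flow f t₁ t₀ y‖ :=
        seminorm_flow_sub_le_exp_mul hNC hfc hf hfd ht₁ ha ht hS (convex_convexHull ℝ _)
          (fun τ hτ => hlog τ hτ.1)
          (fun _ hv _ hw =>
            seminorm_sub_le_of_lipschitzOnWith hNC (hM' a (right_mem_Icc.2 ha)) hv hw)
          (hmem x hx) (hmem y hy)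
    _ ≤ Real.exp (c * (t - a)) * (C * M' : ℝ≥0) * (M * ‖x - y‖) := by
        gcongr
        exact hMt₁.norm_sub_le hx hy
    _ = (C * M' * M : ℝ≥0) * Real.exp (c * (t - a)) * ‖x - y‖ := by
        push_cast
        ring

theorem topEntropy_le_finrank_mul_of_logNormLE (hfc : ForwardComplete t₀ f)
    (hf : IsLocallyLipschitzFrom t₀ f) (hfd : ∀ t, t₀ ≤ t → Differentiable ℝ (f t))
    (hK : Bornology.IsBounded K) (p : Seminorm ℝ E) (hN : IsNorm N) (hc : 0 ≤ c)
    (ht₁ : t₀ ≤ t₁)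
    (hlog : ∀ᶠ t in atTop, ∀ v ∈ convexHull ℝ (reachableSet f t₁ t₀ K),
      LogNormLE N (fderiv ℝ (f t) (flow f t t₁ v)) c) :
    topEntropy p f t₀ K ≤ ((Module.finrank ℝ E * c : ℝ) : EReal) := by
  have : ProperSpace E := FiniteDimensional.proper_real E
  obtain ⟨a, ha, hlog⟩ := (atTop_basis' t₁).eventually_iff.1 hlog
  obtain ⟨D, hD⟩ := exists_seminorm_flow_sub_le_exp_mul hfc hf hfd hK ht₁ ha fun t ht => hlog ht
  obtain ⟨B, hB⟩ := hN.exists_seminorm_le p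
  obtain ⟨C, hC⟩ := exists_lipschitzWith_seminorm (continuous_seminorm p)
  obtain ⟨M, hM⟩ := hfc.exists_lipschitzOnWith_flow hf le_rfl a hK
  refine topEntropy_le_finrank_mul (D := max (C * M) (B * D)) hK hc fun t ht x hx y hy => ?_
  rcases le_total t a with hta | hat
  · calc p (flow f t t₀ x - flow f t t₀ y) ≤ (C * M : ℝ≥0) * ‖x - y‖ :=
          seminorm_sub_le_of_lipschitzOnWith hC (hM t ⟨ht, hta⟩) hx hy
      _ ≤ (max (C * M) (B * D) : ℝ≥0) * Real.exp (c * (t - t₀)) * ‖x - y‖ := by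
          gcongr
          exact (NNReal.coe_le_coe.2 (le_max_left _ _)).trans
            (le_mul_of_one_le_right NNReal.zero_le_coe
              (Real.one_le_exp (mul_nonneg hc (sub_nonneg.2 ht))))
  · calc p (flow f t t₀ x - flow f t t₀ y)
        ≤ B * (D * Real.exp (c * (t - a)) * ‖x - y‖) :=
          (hB _).trans (mul_le_mul_of_nonneg_left (hD t hat x hx y hy) NNReal.zero_le_coe)
      _ = (B * D : ℝ≥0) * Real.exp (c * (t - a)) * ‖x - y‖ := by
          push_cast
          ring
      _ ≤ (max (C * M) (B * D) : ℝ≥0) * Real.exp (c * (t - t₀)) * ‖x - y‖ := by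
          gcongr
          · exact le_max_right _ _
          · exact ht₁.trans ha

theorem topEntropy_le_mul_of_muHatStar_lt {m : ℕ} [NeZero m] {n : Fin m → ℕ} [∀ i, NeZero (n i)]
    {f : ℝ → State n → State n} (hfc : ForwardComplete t₀ f) (hf : IsLocallyLipschitzFrom t₀ f)
    (hfd : ∀ t, t₀ ≤ t → Differentiable ℝ (f t)) {K : Set (State n)}
    (hK : Bornology.IsBounded K) (p : Seminorm ℝ (State n))
    {loc : (i : Fin m) → Seminorm ℝ (Fin (n i) → ℝ)} (hloc : ∀ i, IsNorm (loc i))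
    {net : Seminorm ℝ (Fin m → ℝ)} (hnet : IsNorm net) (hmono : IsMonotoneNorm net)
    (hc : 0 ≤ c) (hlt : muHatStar net loc f t₀ K < c) :
    topEntropy p f t₀ K ≤ (((∑ i, n i : ℕ) * c : ℝ) : EReal) := by
  obtain ⟨t₁, ht₁⟩ := iInf_lt_iff.1 hlt
  obtain ⟨ht₁, hlimsup⟩ := iInf_lt_iff.1 ht₁
  have hlog : ∀ᶠ t in atTop, ∀ v ∈ convexHull ℝ (reachableSet f t₁ t₀ K),
      LogNormLE (aggregateSeminorm net hmono loc) (fderiv ℝ (f t) (flow f t t₁ v)) c := by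
    filter_upwards [eventually_lt_of_limsup_lt hlimsup] with t ht v hv
    exact logNormLE_aggregateSeminorm hnet hmono hloc
      (EReal.coe_le_coe_iff.1 ((iSup₂_le_iff.1 ht.le) v hv))
  have hdim : Module.finrank ℝ (State n) = ∑ i, n i := by
    simp [Module.finrank_pi_fintype]
  rw [← hdim]
  exact topEntropy_le_finrank_mul_of_logNormLE hfc hf hfd hK p
    (isNorm_aggregateSeminorm hnet hloc) hc ht₁ hlog

end EntropyBound

end TVEntropy

end

theorem corollary4_general {m : ℕ} [NeZero m] {n : Fin m → ℕ} [∀ i, NeZero (n i)]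
    {f : ℝ → TVEntropy.State n → TVEntropy.State n} {t₀ : ℝ}
    (hf : TVEntropy.IsLocallyLipschitzFrom t₀ f) (hfd : ∀ t, t₀ ≤ t → Differentiable ℝ (f t))
    (hfc : TVEntropy.ForwardComplete t₀ f)
    {K : Set (TVEntropy.State n)} (hK : Bornology.IsBounded K)
    (p : Seminorm ℝ (TVEntropy.State n))
    {loc : (i : Fin m) → Seminorm ℝ (Fin (n i) → ℝ)} (hloc : ∀ i, TVEntropy.IsNorm (loc i))
    {net : Seminorm ℝ (Fin m → ℝ)} (hnet : TVEntropy.IsNorm net)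
    (hmono : TVEntropy.IsMonotoneNorm net) :
    TVEntropy.topEntropy p f t₀ K ≤
      ((∑ i, n i : ℕ) : EReal) * max (TVEntropy.muHatStar net loc f t₀ K) 0 := by
  have hd : 0 < ∑ i, n i :=
    Finset.sum_pos (fun i _ => NeZero.pos (n i)) Finset.univ_nonempty
  rw [← EReal.div_le_iff_le_mul (by exact_mod_cast hd) (EReal.natCast_ne_top _)]
  refine EReal.le_of_forall_lt_iff_le.1 fun c hc => ?_
  obtain ⟨hμ, hc0⟩ := max_lt_iff.1 hc
  rw [EReal.div_le_iff_le_mul (by exact_mod_cast hd) (EReal.natCast_ne_top _)]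
  refine (TVEntropy.topEntropy_le_mul_of_muHatStar_lt hfc hf hfd hK p hloc hnet hmono
    (EReal.coe_nonneg.1 hc0.le) hμ).trans_eq ?_
  rw [EReal.coe_mul, EReal.coe_natCast]

theorem corollary4 (m : ℕ) (hm : 2 ≤ m) (n : Fin m → ℕ) (hn : ∀ i, 1 ≤ n i)
    (f : ℝ → TVEntropy.State n → TVEntropy.State n) (t₀ : ℝ)
    (hf : TVEntropy.RegularFrom t₀ f) (hfc : TVEntropy.ForwardComplete t₀ f)
    (K : Set (TVEntropy.State n)) (hK : IsCompact K) (hKint : (interior K).Nonempty)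
    (p : Seminorm ℝ (TVEntropy.State n)) (hp : TVEntropy.IsNorm p)
    (loc : (i : Fin m) → Seminorm ℝ (Fin (n i) → ℝ)) (hloc : ∀ i, TVEntropy.IsNorm (loc i))
    (net : Seminorm ℝ (Fin m → ℝ)) (hnet : TVEntropy.IsNorm net)
    (hnet_mono : TVEntropy.IsMonotoneNorm net) :
    TVEntropy.topEntropy p f t₀ K ≤
      ((∑ i, n i : ℕ) : EReal) * max (TVEntropy.muHatStar net loc f t₀ K) 0 := by
  have : NeZero m := ⟨by omega⟩
  have : ∀ i, NeZero (n i) := fun i => NeZero.of_pos (hn i)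
  exact corollary4_general hf.isLocallyLipschitzFrom (fun _ ht => hf.differentiable ht) hfc
    hK.isBounded p hloc hnet hnet_mono
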